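/- Let $K$ be a number field with ring of integers $\mathcal{O}_K$, let $p$ be an odd prime, and let $\mathfrak{p}\subset\mathcal{O}_K$ be a prime above $p$ with ramification index $e$ and residue class degree $f$ over $p$. Let $K_{\mathfrak{p}}$ be the completion of $K$ at $\mathfrak{p}$ and $v_{\mathfrak{p}}$ the $\mathfrak{p}$-adic valuation, normalized to take the value $1$ on uniformizers. Suppose that $p\nmid e$ and that, inside an algebraic closure of $K_{\mathfrak{p}}$, $K_{\mathfrak{p}}\cap\mathbb{Q}_p(\zeta_{p^\infty})=\mathbb{Q}_p$. Let $m\ge 0$ and let $x^{p^m}-a\in\mathcal{O}_K[x]$ be irreducible. Write $a=a_0\pi^{hp^k}$, where $\pi\in\mathcal{O}_K$ with $v_{\mathfrak{p}}(\pi)=1$, $a_0\in K$ with $v_{\mathfrak{p}}(a_0)=0$, and $h\geq 1$, $k\ge 0$ are integers with $p\nmid h$. Let $\mu$ be the integer with $1\le\mu\le f$ and $\mu\equiv m \bmod f$, and put \[ w_0=v_{\mathfrak{p}}\big(a_0^{p^{f-\mu+m}}-a_0\big),\qquad l_0=\left\lceil \frac{w_0}{e}-\frac{p}{p-1}\right\rceil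 , \] with $l_0=\infty$ if $w_0=\infty$. If $l_0\le 0$, suppose that $p\nmid w_0$; and if $l_0<m$, suppose that $p\nmid (e\,l_0-w_0)$. Let $c=\max\big(0,\min(m,l_0,k)\big)$. Then $a$ has a $p^c$-th root in $K_{\mathfrak{p}}$, and for every such root $\sqrt[p^c]{a}\in K_{\mathfrak{p}}$, \[ x^{p^m}-a=\Big(x^{p^{m-c}}-\sqrt[p^c]{a}\Big)\prod_{i=1}^{c}\Phi_{p^i}\Big(x^{p^{m-c}},\sqrt[p^c]{a}\Big) \] is a factorization into irreducibles in $K_{\mathfrak{p}}[x]$, where the product is $1$ if $c=0$. Here \[ \Phi_{p^i}(x,b)=\prod_{\substack{1\le j<p^i\\ \gcd(j,p)=1}}\big(x-\zeta_{p^i}^{\,j}\,b\big) \] is the twisted cyclotomic polynomial, with $\zeta_{p^i}$ a primitive $p^i$-th root of unity; it has coefficients in $K_{\mathfrak{p}}$ for $b=\sqrt[p^c]{a}$. -/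

import Mathlib

open Polynomial NumberField IsDedekindDomain

noncomputable section

/-- The additive valuation `v_𝔭 : K → ℤ ∪ {∞}`, normalized so that a uniformizer has value `1`. -/
def primeOrd {K : Type*} [Field K] [NumberField K] (v : HeightOneSpectrum (𝓞 K)) (x : K) :
    WithTop ℤ :=
  open Classical in
  if x = 0 then ⊤ else ((-(WithZero.log (v.valuation K x)) : ℤ) : WithTop ℤ)

/-- The integer `⌈w / e - p / (p - 1)⌉`. -/
def wieferichLevel (p e : ℕ) (w : ℤ) : ℤ :=
  ⌈(w : ℚ) / (e : ℚ) - (p : ℚ) / ((p : ℚ) - 1)⌉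

/-- The extension of `wieferichLevel` with value `∞` at `w = ∞`. -/
def wieferichLevelTop (p e : ℕ) (w : WithTop ℤ) : WithTop ℤ :=
  w.map (wieferichLevel p e)

/-- The field `ℚ_p` inside `K_𝔭` (with `𝔭` above `p`): the closure of the prime field `ℚ`. -/
def padicSubfield {K : Type*} [Field K] [NumberField K] (v : HeightOneSpectrum (𝓞 K)) :
    Subfield (v.adicCompletion K) :=
  (⊥ : Subfield (v.adicCompletion K)).topologicalClosure

/-- `ℚ_p` inside the algebraic closure of `K_𝔭`. -/
def padicSubfieldInClosure {K : Type*} [Field K] [NumberField K] (v : HeightOneSpectrum (𝓞 K)) :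
    Subfield (AlgebraicClosure (v.adicCompletion K)) :=
  (padicSubfield v).map (algebraMap (v.adicCompletion K) (AlgebraicClosure (v.adicCompletion K)))

/-- The field `ℚ_p(ζ_{p^∞})` inside the algebraic closure of `K_𝔭`, obtained from `ℚ_p` by
adjoining all roots of unity of `p`-power order. -/
def padicCyclotomicSubfield {K : Type*} [Field K] [NumberField K] (p : ℕ)
    (v : HeightOneSpectrum (𝓞 K)) : Subfield (AlgebraicClosure (v.adicCompletion K)) :=
  padicSubfieldInClosure v ⊔
    Subfield.closure {z : AlgebraicClosure (v.adicCompletion K) | ∃ n : ℕ, z ^ p ^ n = 1}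

/-- The twisted cyclotomic polynomial `Φ_{p^j}(x, b) = ∏ (x - ζ^k b)`, the product over
`1 ≤ k < p^j` with `gcd(k, p) = 1`, where `ζ` is a primitive `p^j`-th root of unity. -/
def twistedCyclotomic {L : Type*} [Field L] (p j : ℕ) (ζ b : L) : L[X] :=
  ∏ k ∈ (Finset.Ico 1 (p ^ j)).filter (fun k => Nat.gcd k p = 1), (X - C (ζ ^ k * b))

end

/-! Write `L` for the completion and `N = f - μ + m`, so `N ≥ m ≥ c`. Since `a₀ ^ p ^ N` is visibly
a `p ^ c`-th power, `a₀` is one as soon as the 1-unit `u = a₀ ^ p ^ N / a₀` is, and `u - 1` has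
order `w₀`. If `y` has order `s`, then `(1 + y) ^ p - 1` has order `p * s` when `(p - 1) * s < e`
and `s + e` when `(p - 1) * s > e`. In the second range completeness lets one go back: a 1-unit at
distance `e + s` has a `p`-th root at distance `s`. Each extraction costs `e`, and `l₀` counts how
many are possible (`le_wieferichLevel_iff`). The remaining distance is prime to `p` and at most `p *
e / (p - 1)`, where no further `p`-th root exists (`Valuation.pow_prime_ne_of_not_dvd`). The factor
`π ^ (h * p ^ k)` permits exactly `k` extractions.

Hence for `c < m` a `p ^ c`-th root `α` of `a` is not a `p`-th power, and `X ^ p ^ (m - c) - α` is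
irreducible because `p` is odd.

For the other factors, the cyclotomic polynomials are irreducible over `ℚ_p` by Eisenstein, and over
`L` because `L` meets `ℚ_p(ζ_{p^∞})` only in `ℚ_p`. It remains that `α * ζ` is no `p`-th power in
`L(ζ)`. If it were `γ ^ p`, the automorphism `σ : ζ ↦ ζ ^ 2` would give `(σ γ / γ) ^ p = ζ`, a root
of unity of order `p ^ (i + 1)` in a field of too small degree
(`pow_prime_ne_gen_of_minpoly_eq_scaleRoots`). -/

open WithZero in
/-- The middle terms of the binomial expansion of `(1 + y) ^ p` are small. -/
theorem Valuation.map_one_add_pow_prime_sub_le {L : Type*} [Field L] (V : Valuation L ℤᵐ⁰)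
    {p : ℕ} (hp : p.Prime) (hp2 : p ≠ 2) {y : L} (hy : V y ≤ 1) :
    V ((1 + y) ^ p - 1 - y ^ p - p * y) ≤ V p * V y ^ 2 := by
  obtain ⟨q, rfl⟩ : ∃ q, p = q + 3 := ⟨p - 3, by have := hp.two_le; omega⟩
  have key : (1 + y) ^ (q + 3) - 1 - y ^ (q + 3) - ((q + 3 : ℕ) : L) * y =
      ∑ i ∈ Finset.range (q + 1), y ^ (i + 2) * ((q + 3).choose (i + 2) : L) := by
    rw [add_comm, add_pow, Finset.sum_range_succ, Finset.sum_range_succ', Finset.sum_range_succ']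
    simp
    ring
  rw [key]
  refine V.map_sum_le fun i hi ↦ ?_
  obtain ⟨d, hd⟩ := hp.dvd_choose_self (k := i + 2) (by omega)
    (by have := Finset.mem_range.mp hi; omega)
  have hn : ∀ n : ℕ, V (n : L) ≤ 1 := fun n ↦ by
    induction n with
    | zero => simp
    | succ n ih =>
      push_cast
      exact V.map_add_le ih (by simp)
  rw [hd, Nat.cast_mul, map_mul, map_mul, map_pow, pow_add]
  calc V y ^ i * V y ^ 2 * (V ((q + 3 : ℕ) : L) * V d)
      ≤ 1 * V y ^ 2 * (V ((q + 3 : ℕ) : L) * 1) := by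
        gcongr
        · exact pow_le_one' hy i
        · exact hn d
    _ = _ := by rw [one_mul, mul_one, mul_comm]

open WithZero in
theorem WithZero.exp_neg_natCast_pow (s n : ℕ) :
    (exp (-(s : ℤ)) : ℤᵐ⁰) ^ n = exp (-((n * s : ℕ) : ℤ)) := by
  rw [← exp_nsmul]; simp

/-! ### The order of `(1 + y) ^ p - 1`, and 1-units that are not `p`-th powers. -/

section PthPowers

open WithZero

variable {L : Type*} [Field L] (V : Valuation L ℤᵐ⁰) {p e s : ℕ} {y : L}

/-- Modulo the small middle terms, `(1 + y) ^ p - 1` is `y ^ p + p * y`, of orders `p * s` and `e +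
s`. The smaller order wins. In the tie `(p - 1) * s = e` the terms may cancel, so only an inequality
survives. -/
theorem Valuation.map_one_add_pow_sub_one_of_lt (hp : p.Prime) (hp2 : p ≠ 2)
    (he : V p = exp (-(e : ℤ))) (hy : V y = exp (-(s : ℤ))) (hs : 1 ≤ s) (hlt : (p - 1) * s < e) :
    V ((1 + y) ^ p - 1) = exp (-((p * s : ℕ) : ℤ)) := by
  have hp1 : p * s = (p - 1) * s + s := by
    obtain ⟨q, rfl⟩ : ∃ q, p = q + 1 := ⟨p - 1, by have := hp.two_le; omega⟩
    simp; ring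
  have h1 := V.map_one_add_pow_prime_sub_le hp hp2 (y := y)
    (by rw [hy, ← exp_zero, exp_le_exp]; omega)
  have h2 : V (y ^ p) = exp (-((p * s : ℕ) : ℤ)) := by rw [map_pow, hy, exp_neg_natCast_pow]
  have h3 : V (p * y) = exp (-((e + s : ℕ) : ℤ)) := by
    rw [map_mul, he, hy, ← exp_add]; congr 1; push_cast; ring
  rw [he, hy, exp_neg_natCast_pow, ← exp_add] at h1
  have h4 : V (((1 + y) ^ p - 1 - y ^ p - p * y) + p * y) < V (y ^ p) := by
    rw [h2]
    refine V.map_add_lt (h1.trans_lt ?_) ?_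
    · rw [exp_lt_exp]; push_cast; omega
    · rw [h3, exp_lt_exp]; omega
  rw [← h2, show (1 + y) ^ p - 1 = (((1 + y) ^ p - 1 - y ^ p - p * y) + p * y) + y ^ p by ring]
  exact V.map_add_eq_of_lt_right h4

theorem Valuation.map_one_add_pow_sub_one_of_gt (hp : p.Prime) (hp2 : p ≠ 2)
    (he : V p = exp (-(e : ℤ))) (hy : V y = exp (-(s : ℤ))) (hs : 1 ≤ s) (hlt : e < (p - 1) * s) :
    V ((1 + y) ^ p - 1) = exp (-((s + e : ℕ) : ℤ)) := by
  have hp1 : p * s = (p - 1) * s + s := by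
    obtain ⟨q, rfl⟩ : ∃ q, p = q + 1 := ⟨p - 1, by have := hp.two_le; omega⟩
    simp; ring
  have h1 := V.map_one_add_pow_prime_sub_le hp hp2 (y := y)
    (by rw [hy, ← exp_zero, exp_le_exp]; omega)
  have h2 : V (y ^ p) = exp (-((p * s : ℕ) : ℤ)) := by rw [map_pow, hy, exp_neg_natCast_pow]
  have h3 : V (p * y) = exp (-((s + e : ℕ) : ℤ)) := by
    rw [map_mul, he, hy, ← exp_add]; congr 1; push_cast; ring
  rw [he, hy, exp_neg_natCast_pow, ← exp_add] at h1
  have h4 : V (((1 + y) ^ p - 1 - y ^ p - p * y) + y ^ p) < V (p * y) := by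
    rw [h3]
    refine V.map_add_lt (h1.trans_lt ?_) ?_
    · rw [exp_lt_exp]; push_cast; omega
    · rw [h2, exp_lt_exp]; omega
  rw [← h3, show (1 + y) ^ p - 1 = (((1 + y) ^ p - 1 - y ^ p - p * y) + y ^ p) + p * y by ring]
  exact V.map_add_eq_of_lt_right h4

theorem Valuation.map_one_add_pow_sub_one_le_of_eq (hp : p.Prime) (hp2 : p ≠ 2)
    (he : V p = exp (-(e : ℤ))) (hy : V y = exp (-(s : ℤ))) (heq : (p - 1) * s = e) :
    V ((1 + y) ^ p - 1) ≤ exp (-((p * s : ℕ) : ℤ)) := by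
  have hp1 : p * s = (p - 1) * s + s := by
    obtain ⟨q, rfl⟩ : ∃ q, p = q + 1 := ⟨p - 1, by have := hp.two_le; omega⟩
    simp; ring
  have h1 := V.map_one_add_pow_prime_sub_le hp hp2 (y := y)
    (by rw [hy, ← exp_zero, exp_le_exp]; omega)
  have h2 : V (y ^ p) = exp (-((p * s : ℕ) : ℤ)) := by rw [map_pow, hy, exp_neg_natCast_pow]
  have h3 : V (p * y) = exp (-((s + e : ℕ) : ℤ)) := by
    rw [map_mul, he, hy, ← exp_add]; congr 1; push_cast; ring
  rw [he, hy, exp_neg_natCast_pow, ← exp_add] at h1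
  rw [show (1 + y) ^ p - 1 = (((1 + y) ^ p - 1 - y ^ p - p * y) + y ^ p) + p * y by ring]
  refine V.map_add_le (V.map_add_le (h1.trans ?_) h2.le) ?_
  · rw [exp_le_exp]; push_cast; omega
  · rw [h3, exp_le_exp]; omega

/-- A nonzero element of valuation less than one has a positive integral order. -/
theorem Valuation.exists_eq_exp_neg_of_lt_one (hy0 : y ≠ 0) (hy : V y < 1) :
    ∃ s : ℕ, 1 ≤ s ∧ V y = exp (-(s : ℤ)) := by
  have h0 : V y ≠ 0 := V.ne_zero_iff.mpr hy0
  rw [← exp_log h0, ← exp_zero, exp_lt_exp] at hy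
  refine ⟨(-log (V y)).toNat, by omega, ?_⟩
  rw [Int.toNat_of_nonneg (by omega), neg_neg, exp_log h0]

/-- A `1`-unit at prime-to-`p` distance at most `e p / (p - 1)` from `1` is not a `p`-th power. -/
theorem Valuation.pow_prime_ne_of_not_dvd (hp : p.Prime) (hp2 : p ≠ 2)
    (he : V p = exp (-(e : ℤ))) (he1 : 1 ≤ e) {b : L} (hb : V (b - 1) = exp (-(s : ℤ)))
    (hs : 1 ≤ s) (hps : ¬ p ∣ s) (hle : (p - 1) * s ≤ p * e) (d : L) : d ^ p ≠ b := by
  rintro rfl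
  have hp2' := hp.two_le
  have hb1 : V (d ^ p - 1) < 1 := by rw [hb, ← exp_zero, exp_lt_exp]; omega
  have hd : V d = 1 := by
    have : V (d ^ p) = 1 := by
      have := V.map_one_add_of_lt hb1
      simpa using this
    rw [map_pow] at this
    exact (pow_eq_one_iff.mp this).resolve_right (by omega)
  -- Frobenius is injective on the residue field: `(d - 1) ^ p` agrees with `d ^ p - 1` modulo `p`.
  have hd1 : V (d - 1) < 1 := by
    have hle1 : V (d - 1) ≤ 1 := V.map_sub_le hd.le (by simp)
    have h1 := V.map_one_add_pow_prime_sub_le hp hp2 hle1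
    have hpl : V (p : L) < 1 := by rw [he, ← exp_zero, exp_lt_exp]; omega
    have h2 : V ((d - 1) ^ p) < 1 := by
      rw [show (d - 1) ^ p = (d ^ p - 1) - p * (d - 1) -
        ((1 + (d - 1)) ^ p - 1 - (d - 1) ^ p - p * (d - 1)) by
          rw [show 1 + (d - 1) = d by ring]; ring]
      refine V.map_sub_lt (V.map_sub_lt hb1 ?_) (h1.trans_lt ?_)
      · rw [map_mul]; exact mul_lt_one_of_lt_of_le hpl hle1
      · exact mul_lt_one_of_lt_of_le hpl (pow_le_one' hle1 2)
    rw [map_pow] at h2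
    exact (pow_lt_one_iff (by omega)).mp h2
  have hne : d - 1 ≠ 0 := by
    intro h0
    rw [sub_eq_zero] at h0
    subst h0
    simp at hb
    exact exp_ne_zero hb.symm
  obtain ⟨t, ht, hdt⟩ := V.exists_eq_exp_neg_of_lt_one hne hd1
  have hd' : 1 + (d - 1) = d := by ring
  have hp1 : p * t = (p - 1) * t + t := by
    obtain ⟨q, rfl⟩ : ∃ q, p = q + 1 := ⟨p - 1, by omega⟩
    simp; ring
  rcases lt_trichotomy ((p - 1) * t) e with h | h | h
  · have := V.map_one_add_pow_sub_one_of_lt hp hp2 he hdt ht h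
    rw [hd', hb, exp_inj] at this
    exact hps ⟨t, by omega⟩
  -- In the tie, `p * t` is a lower bound for `s`, while `hle` makes it an upper bound; so `s = p *
  -- t`, again divisible by `p`.
  · have := V.map_one_add_pow_sub_one_le_of_eq hp hp2 he hdt h
    rw [hd', hb, exp_le_exp] at this
    have h5 : p * t ≤ s := by omega
    have h6 : (p - 1) * s ≤ (p - 1) * (p * t) := by
      rw [← h] at hle; exact hle.trans (le_of_eq (by ring))
    exact hps ⟨t, le_antisymm (Nat.le_of_mul_le_mul_left h6 (by omega)) h5⟩
  · have := V.map_one_add_pow_sub_one_of_gt hp hp2 he hdt ht h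
    rw [hd', hb, exp_inj] at this
    have h5 : s = t + e := by omega
    have h6 : p * e = (p - 1) * e + e := by
      obtain ⟨q, rfl⟩ : ∃ q, p = q + 1 := ⟨p - 1, by omega⟩
      simp; ring
    rw [h5, mul_add] at hle
    omega

end PthPowers

/-! ### One Newton step towards a `p`-th root. -/

section Approximation

open WithZero

variable {L : Type*} [Field L] {p e s : ℕ} {b : L}

/-- One step of the successive approximation of a `p`-th root of a `1`-unit. -/
theorem Valuation.exists_map_sub_pow_prime_le (V : Valuation L ℤᵐ⁰) (hp : p.Prime) (hp2 : p ≠ 2)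
    (he : V p = exp (-(e : ℤ))) (hb : V (b - 1) ≤ exp (-((e + s : ℕ) : ℤ)))
    (hs : 1 ≤ s) (hes : e < (p - 1) * s) :
    ∃ c : L, V (c - 1) ≤ exp (-(s : ℤ)) ∧ V (b - c ^ p) ≤ exp (-((e + s + 1 : ℕ) : ℤ)) := by
  have hp0 : (p : L) ≠ 0 := by
    intro h0
    rw [h0, map_zero] at he
    exact exp_ne_zero he.symm
  have hp1 : p * s = (p - 1) * s + s := by
    obtain ⟨q, rfl⟩ : ∃ q, p = q + 1 := ⟨p - 1, by have := hp.two_le; omega⟩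
    simp; ring
  -- The linear term `p * y` matches `b - 1` exactly. The error `y ^ p` has order at least `p * s >
  -- e + s`, which is where `e < (p - 1) * s` enters.
  set y := (b - 1) / p with hy
  have hby : b - 1 = p * y := by rw [hy]; field_simp
  have hVy : V y ≤ exp (-(s : ℤ)) := by
    rw [hy, map_div₀, he, div_le_iff₀ exp_pos, ← exp_add]
    exact hb.trans (le_of_eq (by congr 1; push_cast; ring))
  refine ⟨1 + y, by simpa using hVy, ?_⟩
  have h1 := V.map_one_add_pow_prime_sub_le hp hp2 (y := y)
    (hVy.trans (by rw [← exp_zero, exp_le_exp]; omega))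
  rw [show b - (1 + y) ^ p = -(((1 + y) ^ p - 1 - y ^ p - p * y) + y ^ p) by
    linear_combination hby, Valuation.map_neg]
  refine V.map_add_le (h1.trans ?_) ?_
  · calc V p * V y ^ 2 ≤ V p * exp (-(s : ℤ)) ^ 2 := by gcongr
      _ ≤ _ := by
        rw [he, exp_neg_natCast_pow, ← exp_add, exp_le_exp]; push_cast; omega
  · rw [map_pow]
    calc V y ^ p ≤ exp (-(s : ℤ)) ^ p := by gcongr
      _ ≤ _ := by rw [exp_neg_natCast_pow, exp_le_exp]; omega

theorem Valuation.map_pow_sub_pow_le (V : Valuation L ℤᵐ⁰) {x y : L} (hx : V x ≤ 1)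
    (hy : V y ≤ 1) (n : ℕ) : V (x ^ n - y ^ n) ≤ V (x - y) := by
  rw [← geom_sum₂_mul, map_mul]
  refine mul_le_of_le_one_left' (V.map_sum_le fun i _ ↦ ?_)
  rw [map_mul, map_pow, map_pow]
  exact mul_le_one' (pow_le_one' hx _) (pow_le_one' hy _)

end Approximation

/-! ### Roots of 1-units in a complete field. -/

section CompleteRoots

open WithZero Filter Topology

variable {L : Type*} [Field L] [Valued L ℤᵐ⁰]

/-- A sequence in a complete discretely valued field whose increments tend to zero has a limit. -/
theorem Valued.exists_forall_map_sub_le_exp_neg [CompleteSpace L] (N : ℕ) (u : ℕ → L)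
    (hu : ∀ n, Valued.v (u (n + 1) - u n) ≤ exp (-((N + n : ℕ) : ℤ))) :
    ∃ x, ∀ n, Valued.v (x - u n) ≤ exp (-((N + n : ℕ) : ℤ)) := by
  have hmn : ∀ n k, Valued.v (u (n + k) - u n) ≤ exp (-((N + n : ℕ) : ℤ)) := by
    intro n k
    induction k with
    | zero => simp
    | succ k ih =>
      rw [show u (n + (k + 1)) - u n = (u (n + k + 1) - u (n + k)) + (u (n + k) - u n) by
        rw [← add_assoc]; ring]
      refine Valuation.map_add_le _ ((hu _).trans ?_) ih
      rw [exp_le_exp]; push_cast; omega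
  have hc : CauchySeq u := by
    rw [CauchySeq, Valued.cauchy_iff]
    refine ⟨inferInstance, fun γ ↦ ?_⟩
    have hγ : MonoidWithZeroHom.ValueGroup₀.embedding γ.1 ≠ 0 := by simp
    obtain ⟨n, hn⟩ : ∃ n : ℕ, exp (-((N + n : ℕ) : ℤ)) <
        MonoidWithZeroHom.ValueGroup₀.embedding γ.1 := by
      refine ⟨(-log (MonoidWithZeroHom.ValueGroup₀.embedding γ.1)).toNat + 1, ?_⟩
      rw [← lt_log_iff_exp_lt hγ]
      push_cast
      have := Int.self_le_toNat (-log (MonoidWithZeroHom.ValueGroup₀.embedding γ.1))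
      omega
    refine ⟨u '' Set.Ici n, image_mem_map (Ici_mem_atTop n), ?_⟩
    rintro _ ⟨i, hi, rfl⟩ _ ⟨j, hj, rfl⟩
    rw [Valuation.restrict_lt_iff_lt_embedding]
    refine lt_of_le_of_lt ?_ hn
    obtain ⟨i, rfl⟩ := Nat.exists_eq_add_of_le hi
    obtain ⟨j, rfl⟩ := Nat.exists_eq_add_of_le hj
    rw [show u (n + j) - u (n + i) = (u (n + j) - u n) - (u (n + i) - u n) by ring]
    exact Valuation.map_sub_le _ (hmn _ _) (hmn _ _)
  obtain ⟨x, hx⟩ := cauchySeq_tendsto_of_complete hc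
  refine ⟨x, fun n ↦ ?_⟩
  by_cases h0 : Valued.v (x - u n) = 0
  · rw [h0]; exact zero_le
  -- The valuation is locally constant away from `0`, so the limit has the valuation of some `u k -
  -- u n` with `k ≥ n`.
  have h1 : Tendsto (fun k ↦ u k - u n) atTop (𝓝 (x - u n)) := hx.sub_const _
  obtain ⟨k, hk, hnk⟩ := ((h1.eventually (Valued.locally_const h0)).and
    (eventually_ge_atTop n)).exists
  obtain ⟨k, rfl⟩ := Nat.exists_eq_add_of_le hnk
  rw [← hk]
  exact hmn n k

variable {p e s : ℕ} {b : L}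

/-- In a complete discretely valued field of mixed characteristic, a `1`-unit sufficiently close
to `1` has a `p`-th root, whose distance to `1` is known. -/
theorem Valued.exists_pow_prime_eq [CompleteSpace L] (hp : p.Prime) (hp2 : p ≠ 2)
    (he : (Valued.v (p : L) : ℤᵐ⁰) = exp (-(e : ℤ)))
    (hb : Valued.v (b - 1) = exp (-((e + s : ℕ) : ℤ))) (hs : 1 ≤ s) (hes : e < (p - 1) * s) :
    ∃ x : L, x ^ p = b ∧ Valued.v (x - 1) = exp (-(s : ℤ)) := by
  -- Corrections are multiplicative: the Newton step is applied to the 1-unit `b / u ^ p`, and `u`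
  -- is replaced by `u * c`.
  have step : ∀ n : ℕ, ∀ u : L, (Valued.v u = 1 ∧
      Valued.v (b - u ^ p) ≤ exp (-((e + (s + n) : ℕ) : ℤ))) →
      ∃ u' : L, (Valued.v u' = 1 ∧ Valued.v (b - u' ^ p) ≤ exp (-((e + (s + n) + 1 : ℕ) : ℤ))) ∧
        Valued.v (u' - u) ≤ exp (-((s + n : ℕ) : ℤ)) := by
    rintro n u ⟨hu, hub⟩
    have hu0 : u ≠ 0 := by rintro rfl; simp at hu
    have h1 : Valued.v (b / u ^ p - 1) ≤ exp (-((e + (s + n) : ℕ) : ℤ)) := by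
      rw [show b / u ^ p - 1 = (b - u ^ p) / u ^ p by field_simp, map_div₀, map_pow, hu]
      simpa using hub
    obtain ⟨c, hc1, hc2⟩ := Valued.v.exists_map_sub_pow_prime_le hp hp2 he h1 (by omega)
      (hes.trans_le (Nat.mul_le_mul_left _ (by omega)))
    have hc : Valued.v c = 1 := by
      have : Valued.v (c - 1) < (1 : ℤᵐ⁰) := hc1.trans_lt (by rw [← exp_zero, exp_lt_exp]; omega)
      simpa using Valued.v.map_one_add_of_lt this
    refine ⟨u * c, ⟨by simp [hu, hc], ?_⟩, ?_⟩
    · rw [show b - (u * c) ^ p = u ^ p * (b / u ^ p - c ^ p) by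
        rw [mul_pow]; field_simp, map_mul, map_pow, hu]
      simpa using hc2
    · rw [show u * c - u = u * (c - 1) by ring, map_mul, hu, one_mul]
      exact hc1
  choose! g hg using step
  let u : ℕ → L := fun n ↦ Nat.rec 1 (fun n u ↦ g n u) n
  have hu : ∀ n, Valued.v (u n) = 1 ∧
      Valued.v (b - u n ^ p) ≤ exp (-((e + (s + n) : ℕ) : ℤ)) := by
    intro n
    induction n with
    | zero => exact ⟨by simp [u], by simpa [u] using hb.le⟩
    | succ n ih => exact (hg n (u n) ih).1
  obtain ⟨x, hx⟩ := Valued.exists_forall_map_sub_le_exp_neg s u fun n ↦ (hg n (u n) (hu n)).2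
  have hx1 : Valued.v (x - 1) ≤ exp (-(s : ℤ)) := by simpa [u] using hx 0
  have hx1' : Valued.v (x - 1) < (1 : ℤᵐ⁰) :=
    hx1.trans_lt (by rw [← exp_zero, exp_lt_exp]; omega)
  have hVx : Valued.v x = 1 := by simpa using Valued.v.map_one_add_of_lt hx1'
  have hxb : x ^ p = b := by
    have hle : ∀ n : ℕ, Valued.v (b - x ^ p) ≤ exp (-(n : ℤ)) := fun n ↦ by
      rw [show b - x ^ p = (b - u n ^ p) - (x ^ p - u n ^ p) by ring]
      refine Valuation.map_sub_le _ ((hu n).2.trans ?_)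
        ((Valued.v.map_pow_sub_pow_le hVx.le (hu n).1.le p).trans ((hx n).trans ?_))
      all_goals rw [exp_le_exp]; push_cast; omega
    by_contra hne
    have h0 : Valued.v (b - x ^ p) ≠ 0 :=
      (Valuation.ne_zero_iff _).mpr (sub_ne_zero.mpr (Ne.symm hne))
    have := hle ((-log (Valued.v (b - x ^ p))).toNat + 1)
    rw [← log_le_iff_le_exp h0] at this
    push_cast at this
    have := Int.self_le_toNat (-log (Valued.v (b - x ^ p)))
    omega
  have hx0 : x - 1 ≠ 0 := by
    intro h0
    rw [sub_eq_zero] at h0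
    rw [← hxb, h0, one_pow, sub_self, map_zero] at hb
    exact exp_ne_zero hb.symm
  obtain ⟨t, ht, hxt⟩ := Valued.v.exists_eq_exp_neg_of_lt_one hx0 hx1'
  -- Since `t ≥ s` stays in the range where `p`-th powers add exactly `e` to the order, `t + e = e +
  -- s`.
  have hst : s ≤ t := by
    rw [hxt, exp_le_exp] at hx1; omega
  have := Valued.v.map_one_add_pow_sub_one_of_gt hp hp2 he hxt ht
    (hes.trans_le (Nat.mul_le_mul_left _ hst))
  rw [add_sub_cancel, hxb, hb, exp_inj] at this
  exact ⟨x, hxb, by rw [hxt]; congr 2; omega⟩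

theorem Valued.exists_pow_prime_pow_eq [CompleteSpace L] (hp : p.Prime) (hp2 : p ≠ 2)
    (he : (Valued.v (p : L) : ℤᵐ⁰) = exp (-(e : ℤ))) (c : ℕ)
    (hb : Valued.v (b - 1) = exp (-((c * e + s : ℕ) : ℤ))) (hs : 1 ≤ s)
    (hes : e < (p - 1) * s) :
    ∃ x : L, x ^ p ^ c = b ∧ Valued.v (x - 1) = exp (-(s : ℤ)) := by
  induction c generalizing b with
  | zero => exact ⟨b, by simp, by simpa using hb⟩
  | succ c ih =>
    obtain ⟨y, hyb, hy⟩ := Valued.exists_pow_prime_eq (s := c * e + s) hp hp2 he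
      (by rw [hb]; congr 2; push_cast; ring) (by omega)
      (hes.trans_le (Nat.mul_le_mul_left _ (by omega)))
    obtain ⟨x, hxy, hx⟩ := ih hy
    exact ⟨x, by rw [pow_succ, pow_mul, hxy, hyb], hx⟩

end CompleteRoots

/-! ### Twisted cyclotomic polynomials and the factorization. -/

section TwistedCyclotomic

theorem Polynomial.irreducible_scaleRoots {F : Type*} [Field F] {g : F[X]} (hg : Irreducible g)
    {r : F} (hr : r ≠ 0) : Irreducible (g.scaleRoots r) := by
  have hunit : ∀ (q : F[X]) (s : F), IsUnit (q.scaleRoots s) → IsUnit q := fun q s h ↦ by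
    rw [isUnit_iff_degree_eq_zero] at h ⊢
    rwa [degree_scaleRoots] at h
  refine ⟨fun h ↦ hg.not_isUnit (hunit _ _ h), fun a b hab ↦ ?_⟩
  have : g = a.scaleRoots r⁻¹ * b.scaleRoots r⁻¹ := by
    rw [← mul_scaleRoots_of_noZeroDivisors, ← hab, ← scaleRoots_mul, mul_inv_cancel₀ hr,
      scaleRoots_one]
  exact (hg.isUnit_or_isUnit this).imp (hunit _ _) (hunit _ _)

theorem Polynomial.X_pow_sub_C_scaleRoots {F : Type*} [Field F] {n : ℕ} (hn : n ≠ 0) (a r : F) :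
    (X ^ n - C a : F[X]).scaleRoots r = X ^ n - C (a * r ^ n) := by
  ext i
  rw [coeff_scaleRoots, natDegree_X_pow_sub_C, coeff_sub, coeff_sub, coeff_X_pow, coeff_C, coeff_C]
  by_cases hi : i = n
  · subst hi; simp [hn]
  · by_cases h0 : i = 0
    · subst h0; simp [hi]
    · simp [hi, h0]

theorem Polynomial.prod_scaleRoots {F ι : Type*} [Field F] (s : Finset ι) (g : ι → F[X]) (r : F) :
    (∏ i ∈ s, g i).scaleRoots r = ∏ i ∈ s, (g i).scaleRoots r := by
  classical
  induction s using Finset.induction_on with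
  | empty => simp
  | insert a s ha ih =>
    rw [Finset.prod_insert ha, Finset.prod_insert ha, mul_scaleRoots_of_noZeroDivisors, ih]

/-- The right-hand side makes sense without `ζ`, which is how the twisted polynomial descends to a
field not containing the roots of unity. -/
theorem twistedCyclotomic_eq_scaleRoots {F : Type*} [Field F] {p i : ℕ} (hp : p.Prime)
    (hi : 1 ≤ i) {ζ : F} (hζ : IsPrimitiveRoot ζ (p ^ i)) (b : F) :
    twistedCyclotomic p i ζ b = (cyclotomic (p ^ i) F).scaleRoots b := by
  have hpos : 0 < p ^ i := pow_pos hp.pos i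
  have : NeZero (p ^ i) := ⟨hpos.ne'⟩
  have h1 : 1 < p ^ i := Nat.one_lt_pow (by omega) hp.one_lt
  rw [cyclotomic_eq_prod_X_sub_primitiveRoots hζ, prod_scaleRoots, twistedCyclotomic]
  refine Finset.prod_nbij (fun k ↦ ζ ^ k) ?_ ?_ ?_ ?_
  · intro k hk
    rw [Finset.mem_filter, Finset.mem_Ico] at hk
    rw [mem_primitiveRoots hpos]
    exact hζ.pow_of_coprime k (Nat.Coprime.pow_right i hk.2)
  · intro k hk l hl hkl
    simp only [Finset.coe_filter, Set.mem_ofPred_eq, Finset.mem_Ico] at hk hl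
    exact hζ.pow_inj hk.1.2 hl.1.2 hkl
  · intro ξ hξ
    rw [Finset.mem_coe, mem_primitiveRoots hpos, hζ.isPrimitiveRoot_iff] at hξ
    obtain ⟨k, hk, hkp, rfl⟩ := hξ
    refine ⟨k, ?_, rfl⟩
    simp only [Finset.coe_filter, Set.mem_ofPred_eq, Finset.mem_Ico]
    refine ⟨⟨?_, hk⟩, Nat.Coprime.coprime_dvd_right (dvd_pow_self p (by omega)) hkp⟩
    rw [Nat.one_le_iff_ne_zero]
    rintro rfl
    rw [Nat.coprime_zero_left] at hkp
    omega
  · intro k _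
    rw [X_sub_C_scaleRoots]

theorem X_pow_prime_pow_sub_one_eq_prod (F : Type*) [Field F] {p : ℕ} (hp : p.Prime) (c : ℕ) :
    (X ^ p ^ c - 1 : F[X]) = (X - 1) * ∏ i ∈ Finset.Icc 1 c, cyclotomic (p ^ i) F := by
  have := Fact.mk hp
  induction c with
  | zero => simp
  | succ c ih =>
    rw [Finset.prod_Icc_succ_top (by omega), ← mul_assoc, ← ih, mul_comm,
      cyclotomic_prime_pow_mul_X_pow_sub_one]

/-- Take the cyclotomic factorization of `X ^ p ^ c - 1`, scale all roots by `b`, and substitute `X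
^ p ^ (m - c)` for `X`. -/
theorem X_pow_prime_pow_sub_C_eq_prod {F : Type*} [Field F] {p m c : ℕ} (hp : p.Prime)
    (hcm : c ≤ m) (b : F) :
    (X ^ p ^ m - C (b ^ p ^ c) : F[X]) = (X ^ p ^ (m - c) - C b) *
      ∏ i ∈ Finset.Icc 1 c, ((cyclotomic (p ^ i) F).scaleRoots b).comp (X ^ p ^ (m - c)) := by
  have h := congrArg (fun q : F[X] ↦ (q.scaleRoots b).comp (X ^ p ^ (m - c)))
    (X_pow_prime_pow_sub_one_eq_prod F hp c)
  have h1 := X_pow_sub_C_scaleRoots (F := F) (pow_pos hp.pos c).ne' 1 b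
  have h2 := X_sub_C_scaleRoots (R := F) 1 b
  rw [map_one, one_mul] at h1 h2
  simp only [mul_scaleRoots_of_noZeroDivisors, prod_scaleRoots, h1, h2, mul_comp, sub_comp, pow_comp,
    X_comp, C_comp, ← pow_mul, ← pow_add, Nat.sub_add_cancel hcm] at h
  rw [h, prod_comp]

end TwistedCyclotomic

/-! ### Irreducibility of the twisted factors. -/

section Irreducibility

variable {F : Type*} [Field F] [CharZero F] {p : ℕ}

open IntermediateField in
/-- If the `p`-power cyclotomic polynomials are irreducible over `F`, then a twist by `b ∈ F` of a
`p`-power root of unity `ζ` is not a `p`-th power in `F(ζ)`. -/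
theorem pow_prime_ne_gen_of_minpoly_eq_scaleRoots (hp : p.Prime) (hp2 : p ≠ 2)
    (hcyc : ∀ i, Irreducible (cyclotomic (p ^ i) F)) {i : ℕ} (hi : 1 ≤ i) {b : F} (hb : b ≠ 0)
    {E : Type*} [Field E] [Algebra F E] {x : E}
    (hx : minpoly F x = (cyclotomic (p ^ i) F).scaleRoots b) (γ : F⟮x⟯) :
    γ ^ p ≠ AdjoinSimple.gen F x := by
  intro hγ
  have hpi : 0 < p ^ i := pow_pos hp.pos i
  have : NeZero (p ^ i) := ⟨hpi.ne'⟩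
  have hint : IsIntegral F x := by
    by_contra h
    rw [minpoly.eq_zero h] at hx
    exact scaleRoots_ne_zero (cyclotomic_ne_zero _ _) b hx.symm
  have : FiniteDimensional F F⟮x⟯ := adjoin.finiteDimensional hint
  set g := AdjoinSimple.gen F x with hg
  set b' := algebraMap F F⟮x⟯ b with hb'
  have hb0 : b' ≠ 0 := by simpa [hb'] using hb
  set ζ := g / b' with hζdef
  have hgζ : g = b' * ζ := by rw [hζdef]; field_simp
  have hscale : ∀ ξ : F⟮x⟯, aeval (b' * ξ) ((cyclotomic (p ^ i) F).scaleRoots b) =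
      b' ^ (cyclotomic (p ^ i) F).natDegree * aeval ξ (cyclotomic (p ^ i) F) := fun ξ ↦
    scaleRoots_eval₂_mul _ _ _
  have hroot : ∀ ξ : F⟮x⟯, aeval ξ (cyclotomic (p ^ i) F) = 0 ↔ IsPrimitiveRoot ξ (p ^ i) := by
    intro ξ
    have : NeZero ((p ^ i : ℕ) : F⟮x⟯) := ⟨by exact_mod_cast hpi.ne'⟩
    rw [← isRoot_cyclotomic_iff, IsRoot.def, ← map_cyclotomic _ (algebraMap F F⟮x⟯), eval_map,
      aeval_def]
  have hζ : IsPrimitiveRoot ζ (p ^ i) := by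
    rw [← hroot]
    have h0 : aeval g ((cyclotomic (p ^ i) F).scaleRoots b) = 0 := by
      rw [← hx, ← minpoly_gen F x]; exact minpoly.aeval _ _
    rw [hgζ, hscale] at h0
    exact (mul_eq_zero.mp h0).resolve_left (pow_ne_zero _ hb0)
  -- As `p` is odd, `ζ ^ 2` is a conjugate of `ζ`. The exponent `2` is chosen so that `σ g / g = ζ`.
  have hζ2 : IsPrimitiveRoot (ζ ^ 2) (p ^ i) :=
    hζ.pow_of_coprime 2 (Nat.Coprime.pow_right i
      ((Nat.coprime_primes Nat.prime_two hp).mpr (Ne.symm hp2)))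
  have hmem : b' * ζ ^ 2 ∈ (minpoly F x).aroots F⟮x⟯ := by
    rw [mem_aroots]
    refine ⟨minpoly.ne_zero hint, ?_⟩
    rw [hx, hscale, (hroot _).mpr hζ2, mul_zero]
  let σ := (algHomAdjoinIntegralEquiv F hint).symm ⟨b' * ζ ^ 2, hmem⟩
  have hσ : σ g = b' * ζ ^ 2 := algHomAdjoinIntegralEquiv_symm_apply_gen F hint _
  have hζ0 : ζ ≠ 0 := hζ.ne_zero hpi.ne'
  have hg0 : g ≠ 0 := by rw [hgζ]; exact mul_ne_zero hb0 hζ0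
  have hγ0 : γ ≠ 0 := by
    rintro rfl
    rw [zero_pow hp.ne_zero] at hγ
    exact hg0 hγ.symm
  have hσγ : σ γ ^ p = b' * ζ ^ 2 := by rw [← map_pow, hγ, hσ]
  have hσγ0 : σ γ ≠ 0 := by simpa using hγ0
  have hθ : (σ γ / γ) ^ p = ζ := by
    rw [div_pow, hσγ, hγ, hgζ]; field_simp
  have hprim : IsPrimitiveRoot (σ γ / γ) (p ^ (i + 1)) := by
    have := Fact.mk hp
    refine (IsPrimitiveRoot.iff_orderOf).mpr (orderOf_eq_prime_pow ?_ ?_)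
    · obtain ⟨j, rfl⟩ : ∃ j, i = j + 1 := ⟨i - 1, by omega⟩
      rw [pow_succ', pow_mul, hθ]
      intro h1
      have := hζ.dvd_of_pow_eq_one _ h1
      exact absurd (Nat.le_of_dvd (pow_pos hp.pos j) this)
        (not_le.mpr (Nat.pow_lt_pow_right hp.one_lt (by omega)))
    · rw [pow_succ', pow_mul, hθ, hζ.pow_eq_one]
  have hpos : 0 < p ^ (i + 1) := pow_pos hp.pos _
  have : NeZero ((p ^ (i + 1) : ℕ) : F) := ⟨by exact_mod_cast hpos.ne'⟩
  have hdeg : (minpoly F (σ γ / γ)).natDegree ≤ (minpoly F x).natDegree := by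
    rw [← adjoin.finrank hint]
    exact minpoly.natDegree_le _
  rw [← hprim.minpoly_eq_cyclotomic_of_irreducible (hcyc _), hx, natDegree_scaleRoots,
    natDegree_cyclotomic, natDegree_cyclotomic, Nat.totient_prime_pow hp (by omega),
    Nat.totient_prime_pow hp (by omega)] at hdeg
  have hp1 : 0 < p - 1 := by have := hp.two_le; omega
  have := Nat.le_of_mul_le_mul_right hdeg hp1
  exact absurd this (not_le.mpr (Nat.pow_lt_pow_right hp.one_lt (by omega)))

/-- By transitivity of degrees it suffices that `X ^ p ^ n - x` is irreducible over `F(x)` for a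
root `x` of the twisted polynomial; for odd `p` this only needs `x` not to be a `p`-th power there.
-/
theorem irreducible_scaleRoots_cyclotomic_comp (hp : p.Prime) (hp2 : p ≠ 2)
    (hcyc : ∀ i, Irreducible (cyclotomic (p ^ i) F)) {i : ℕ} (hi : 1 ≤ i) {b : F} (hb : b ≠ 0)
    (n : ℕ) : Irreducible (((cyclotomic (p ^ i) F).scaleRoots b).comp (X ^ p ^ n)) := by
  refine irreducible_comp ((monic_scaleRoots_iff b).mpr (cyclotomic.monic _ _)) (monic_X_pow _)
    (irreducible_scaleRoots (hcyc i) hb) fun E _ _ x hx ↦ ?_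
  rw [Polynomial.map_pow, map_X]
  exact X_pow_sub_C_irreducible_of_prime_pow hp hp2 n
    (pow_prime_ne_gen_of_minpoly_eq_scaleRoots hp hp2 hcyc hi hb hx)

/-- A field over which the `p`-th cyclotomic polynomial is irreducible has injective `p`-power
maps. -/
theorem eq_of_pow_prime_pow_eq (hp : p.Prime) (hp2 : p ≠ 2)
    (hcyc : Irreducible (cyclotomic p F)) {x y : F} (c : ℕ) (h : x ^ p ^ c = y ^ p ^ c) :
    x = y := by
  -- A primitive `p`-th root of unity in `F` would force the irreducible cyclotomic polynomial, of
  -- degree `p - 1 > 1`, to be linear.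
  have hpow : ∀ z : F, z ^ p = 1 → z = 1 := by
    intro z hz
    by_contra hne
    have hprim : IsPrimitiveRoot z p :=
      (IsPrimitiveRoot.iff_orderOf).mpr (by have := Fact.mk hp; exact orderOf_eq_prime hz hne)
    have : NeZero (p : F) := ⟨by exact_mod_cast hp.ne_zero⟩
    have h1 := degree_eq_one_of_irreducible_of_root hcyc (isRoot_cyclotomic_iff.mpr hprim)
    rw [degree_cyclotomic, Nat.totient_prime hp] at h1
    have : p - 1 = 1 := by exact_mod_cast h1
    omega
  induction c with
  | zero => simpa using h
  | succ c ih =>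
    refine ih ?_
    by_cases hy : y = 0
    · rw [hy, zero_pow (pow_pos hp.pos _).ne'] at h
      rw [hy, eq_zero_of_pow_eq_zero h]
    · have h1 : (x ^ p ^ c / y ^ p ^ c) ^ p = 1 := by
        rw [div_pow, ← pow_mul, ← pow_mul, ← pow_succ, h, div_self (pow_ne_zero _ hy)]
      exact (div_eq_one_iff_eq (pow_ne_zero _ hy)).mp (hpow _ h1)

end Irreducibility

/-! ### Irreducibility of the cyclotomic polynomials over `ℚ_p` and its extension. -/

section CyclotomicIrreducible

open WithZero

/-- The `p`-power cyclotomic polynomials are irreducible over a valued field in which `p` is a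
uniformizer. -/
theorem irreducible_cyclotomic_of_uniformizer {F : Type*} [Field F] [CharZero F]
    (V : Valuation F ℤᵐ⁰) {p : ℕ} (hp : p.Prime) (hp1 : V p < 1)
    (hunif : ∀ x, V x < 1 → V x ≤ V p) (i : ℕ) : Irreducible (cyclotomic (p ^ i) F) := by
  obtain _ | n := i
  · rw [pow_zero, cyclotomic_one]
    simpa using irreducible_X_sub_C (1 : F)
  have := Fact.mk hp
  have hp0 : (p : F) ≠ 0 := by exact_mod_cast hp.ne_zero
  let R := V.valuationSubring
  have hmem : ∀ x : R, V x < 1 ↔ (p : R) ∣ x := by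
    intro x
    constructor
    · intro hx
      refine ⟨⟨x / p, ?_⟩, ?_⟩
      · rw [Valuation.mem_valuationSubring_iff, map_div₀]
        exact div_le_one_of_le₀ (hunif _ hx) zero_le
      · ext
        push_cast
        field_simp
    · rintro ⟨y, rfl⟩
      push_cast
      rw [map_mul]
      exact mul_lt_one_of_lt_of_le hp1 y.2
  have hprime : Prime (p : R) := by
    refine ⟨by exact_mod_cast hp.ne_zero, ?_, ?_⟩
    · rw [isUnit_iff_dvd_one, ← hmem]
      simp
    · intro a b hab
      rw [← hmem, ← hmem]
      rw [← hmem] at hab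
      by_contra! h
      push_cast at hab
      rw [map_mul] at hab
      exact absurd hab (not_lt.mpr (one_le_mul h.1 h.2))
  -- Shifted by `1`, the polynomial is Eisenstein at `p` over `ℤ`; it stays so over the valuation
  -- ring, because `p` is prime there and the constant term is `p` itself.
  let f : R[X] := ((cyclotomic (p ^ (n + 1)) ℤ).comp (X + 1)).map (Int.castRingHom R)
  have hmonic : ((cyclotomic (p ^ (n + 1)) ℤ).comp (X + 1)).Monic := by
    refine (cyclotomic.monic _ ℤ).comp (monic_X_add_C 1) fun h ↦ ?_
    rw [← C_1, natDegree_X_add_C] at h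
    exact one_ne_zero h
  have hfm : f.Monic := hmonic.map _
  have hE := cyclotomic_prime_pow_comp_X_add_one_isEisensteinAt p n
  have hI : (Ideal.span {(p : R)}).IsPrime := (Ideal.span_singleton_prime hprime.ne_zero).mpr hprime
  have hdeg : f.natDegree = Nat.totient (p ^ (n + 1)) := by
    rw [hmonic.natDegree_map, natDegree_comp, ← C_1, natDegree_X_add_C, mul_one,
      natDegree_cyclotomic]
  have hfE : f.IsEisensteinAt (Ideal.span {(p : R)}) := by
    refine hfm.isEisensteinAt_of_mem_of_notMem hI.ne_top ?_ ?_
    · intro k hk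
      rw [hmonic.natDegree_map] at hk
      have := hE.mem hk
      rw [Ideal.submodule_span_eq, Ideal.mem_span_singleton] at this
      rw [Ideal.mem_span_singleton, coeff_map]
      simpa using map_dvd (Int.castRingHom R) this
    · have h0 : f.coeff 0 = p := by
        rw [coeff_map, coeff_zero_eq_eval_zero, eval_comp]
        simp [eval_one_cyclotomic_prime_pow]
      rw [h0, Ideal.span_singleton_pow, Ideal.mem_span_singleton]
      rintro ⟨y, hy⟩
      have : (p : R) * (p * y) = p * 1 := by linear_combination -hy
      exact hprime.not_isUnit (isUnit_iff_dvd_one.mpr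
        ⟨y, (mul_left_cancel₀ hprime.ne_zero this).symm⟩)
  have hirr : Irreducible f := hfE.irreducible hI hfm.isPrimitive
    (hdeg ▸ Nat.totient_pos.mpr (pow_pos hp.pos _))
  have hirr' := (hfm.irreducible_iff_irreducible_map_fraction_map (K := F)).mp hirr
  have hmap : f.map (algebraMap R F) = algEquivAevalXAddC 1 (cyclotomic (p ^ (n + 1)) F) := by
    rw [map_map, map_comp, map_cyclotomic]
    simp [comp, aeval_def]
  rw [hmap] at hirr'
  exact (MulEquiv.irreducible_iff (algEquivAevalXAddC (1 : F))).mp hirr'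

/-- Irreducibility of the `p`-power cyclotomic polynomials passes from a subfield `F` of `E` to `E`
if `E` meets the field generated by `F` and the `p`-power roots of unity in `F`. -/
theorem irreducible_cyclotomic_of_inf_eq {E Ω : Type*} [Field E] [CharZero E] [Field Ω]
    [Algebra E Ω] [IsAlgClosed Ω] {p : ℕ} (hp : p.Prime) (F : Subfield E)
    (hF : (algebraMap E Ω).fieldRange ⊓
      (F.map (algebraMap E Ω) ⊔ Subfield.closure {z : Ω | ∃ n : ℕ, z ^ p ^ n = 1}) =
        F.map (algebraMap E Ω))
    {i : ℕ} (hi : Irreducible (cyclotomic (p ^ i) F)) : Irreducible (cyclotomic (p ^ i) E) := by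
  have hpi : 0 < p ^ i := pow_pos hp.pos i
  have : CharZero Ω := charZero_of_injective_algebraMap (algebraMap E Ω).injective
  have : NeZero ((p ^ i : ℕ) : Ω) := ⟨by exact_mod_cast hpi.ne'⟩
  set S := F.map (algebraMap E Ω) ⊔ Subfield.closure {z : Ω | ∃ n : ℕ, z ^ p ^ n = 1} with hS
  obtain ⟨ζ, hζ⟩ := IsAlgClosed.exists_root (cyclotomic (p ^ i) Ω)
    (degree_cyclotomic_pos _ _ hpi).ne'
  have hζ0 : aeval ζ (cyclotomic (p ^ i) E) = 0 := by
    rw [aeval_def, ← eval_map, map_cyclotomic]; exact hζ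
  have hint : IsIntegral E ζ := ⟨_, cyclotomic.monic _ _, hζ0⟩
  set g := minpoly E ζ with hg
  have hgd : g ∣ cyclotomic (p ^ i) E := minpoly.dvd _ _ hζ0
  -- All roots of `g` are `p`-power roots of unity, so its coefficients lie in `S` as well as in
  -- `E`, hence in `F`. Thus `g` descends to a nontrivial monic factor of a polynomial irreducible
  -- over `F`.
  have hroots : ∀ r ∈ (g.map (algebraMap E Ω)).roots, r ∈ S := by
    intro r hr
    have hr' : IsRoot (cyclotomic (p ^ i) Ω) r := by
      rw [← map_cyclotomic _ (algebraMap E Ω)]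
      exact (isRoot_of_mem_roots hr).dvd (Polynomial.map_dvd _ hgd)
    rw [isRoot_cyclotomic_iff] at hr'
    exact (le_sup_right : _ ≤ S) (Subfield.subset_closure ⟨i, hr'.pow_eq_one⟩)
  have hlift : g.map (algebraMap E Ω) ∈ lifts S.subtype := by
    rw [(IsAlgClosed.splits (g.map (algebraMap E Ω))).eq_prod_roots_of_monic
      ((minpoly.monic hint).map _)]
    refine Submonoid.multiset_prod_mem (lifts S.subtype).toSubmonoid _ fun q hq ↦ ?_
    obtain ⟨r, hr, rfl⟩ := Multiset.mem_map.mp hq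
    exact ⟨X - C ⟨r, hroots r hr⟩, by simp⟩
  have hgF : g ∈ lifts F.subtype := by
    rw [lifts_iff_coeff_lifts]
    intro k
    have h1 : algebraMap E Ω (g.coeff k) ∈ S := by
      obtain ⟨s, hs⟩ := (lifts_iff_coeff_lifts _).mp hlift k
      rw [coeff_map] at hs
      rw [← hs]; exact s.2
    have h2 : algebraMap E Ω (g.coeff k) ∈ F.map (algebraMap E Ω) := by
      rw [← hF]; exact ⟨⟨_, rfl⟩, h1⟩
    obtain ⟨y, hy, hyg⟩ := h2
    exact ⟨⟨y, hy⟩, (algebraMap E Ω).injective hyg⟩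
  obtain ⟨g₀, hg₀, -, hg₀m⟩ := lifts_and_degree_eq_and_monic hgF (minpoly.monic hint)
  have hdvd : g₀ ∣ cyclotomic (p ^ i) F := by
    rw [← map_dvd_map' F.subtype, hg₀, map_cyclotomic]; exact hgd
  have hnu : ¬ IsUnit g₀ := fun h ↦ (minpoly.irreducible hint).not_isUnit (by
    rw [← hg, ← hg₀]; exact h.map (mapRingHom F.subtype))
  have heq : g₀ = cyclotomic (p ^ i) F :=
    eq_of_monic_of_associated hg₀m (cyclotomic.monic _ _)
      ((hi.dvd_iff.mp hdvd).resolve_left hnu).symm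
  rw [← map_cyclotomic (p ^ i) F.subtype, ← heq, hg₀]
  exact minpoly.irreducible hint

theorem Valuation.map_intCast_le_one {L : Type*} [Field L] (V : Valuation L ℤᵐ⁰) (z : ℤ) :
    V (z : L) ≤ 1 := by
  induction z using Int.induction_on with
  | zero => simp
  | succ n ih => push_cast; exact V.map_add_le (by exact_mod_cast ih) (by simp)
  | pred n ih => push_cast; exact V.map_sub_le (by exact_mod_cast ih) (by simp)

theorem Valuation.map_intCast_eq_one {L : Type*} [Field L] (V : Valuation L ℤᵐ⁰) {p : ℕ}
    (hp : p.Prime) (hp1 : V p < 1) {z : ℤ} (hz : ¬ (p : ℤ) ∣ z) : V (z : L) = 1 := by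
  obtain ⟨a, b, hab⟩ := ((Nat.prime_iff_prime_int.mp hp).coprime_iff_not_dvd).mpr hz
  refine le_antisymm (V.map_intCast_le_one z) (not_lt.mp fun hlt ↦ ?_)
  have h1 : (a : L) * p + b * z = 1 := by exact_mod_cast congrArg (Int.cast : ℤ → L) hab
  have h2 : V ((a : L) * p + b * z) < 1 := by
    refine V.map_add_lt ?_ ?_ <;> rw [map_mul, mul_comm]
    · exact mul_lt_one_of_lt_of_le hp1 (V.map_intCast_le_one a)
    · exact mul_lt_one_of_lt_of_le hlt (V.map_intCast_le_one b)
  rw [h1, map_one] at h2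
  exact lt_irrefl _ h2

/-- `p` is a uniformizer of the closure of the prime field. -/
theorem Valued.map_le_of_mem_closure_bot {L : Type*} [Field L] [CharZero L] [Valued L ℤᵐ⁰]
    {p : ℕ} (hp : p.Prime) (hp1 : Valued.v (p : L) < (1 : ℤᵐ⁰)) {x : L}
    (hx : x ∈ (⊥ : Subfield L).topologicalClosure) (hx1 : Valued.v x < (1 : ℤᵐ⁰)) :
    Valued.v x ≤ (Valued.v (p : L) : ℤᵐ⁰) := by
  by_cases h0 : Valued.v x = (0 : ℤᵐ⁰)
  · rw [h0]; exact zero_le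
  have hx' : x ∈ closure ((⊥ : Subfield L) : Set L) := hx
  -- A rational number near `x` has the same valuation, which reduces the claim to `ℚ`.
  obtain ⟨y, hy, hyb⟩ := mem_closure_iff_nhds.mp hx' _ (Valued.locally_const h0)
  change Valued.v y = Valued.v x at hy
  rw [Subfield.bot_eq_of_charZero] at hyb
  obtain ⟨r, rfl⟩ := hyb
  rw [← hy] at hx1 ⊢
  have hr : algebraMap ℚ L r = (r.num : L) / ((r.den : ℤ) : L) := by
    conv_lhs => rw [← Rat.num_div_den r]
    simp
  rw [hr, map_div₀] at hx1 ⊢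
  by_cases hnum : (p : ℤ) ∣ r.num
  · have hden : ¬ (p : ℤ) ∣ (r.den : ℤ) := fun h ↦ by
      have := Nat.dvd_gcd (Int.natCast_dvd.mp hnum) (Int.natCast_dvd_natCast.mp h)
      rw [r.reduced] at this
      exact hp.one_lt.ne' (Nat.dvd_one.mp this)
    obtain ⟨k, hk⟩ := hnum
    rw [Valued.v.map_intCast_eq_one hp hp1 hden, hk, div_one]
    push_cast
    rw [map_mul]
    exact mul_le_of_le_one_right' (Valued.v.map_intCast_le_one k)
  · rw [Valued.v.map_intCast_eq_one hp hp1 hnum] at hx1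
    have hd0 : (Valued.v ((r.den : ℤ) : L) : ℤᵐ⁰) ≠ 0 := by simp
    rw [div_lt_one₀ (zero_lt_iff.mpr hd0)] at hx1
    exact absurd hx1 (not_lt.mpr (Valued.v.map_intCast_le_one _))

end CyclotomicIrreducible

/-! ### Translation to the completion of a number field. -/

section AdicCompletion

open WithZero

variable {K : Type*} [Field K] [NumberField K] (v : HeightOneSpectrum (𝓞 K))

theorem valued_algebraMap_adicCompletion (x : K) :
    Valued.v (algebraMap K (v.adicCompletion K) x) = v.valuation K x := by
  rw [HeightOneSpectrum.algebraMap_adicCompletion]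
  exact HeightOneSpectrum.valuedAdicCompletion_eq_valuation' v x

theorem valuation_natCast_eq_exp_neg_ramificationIdx {p : ℕ} (hp : p.Prime)
    (hv : (p : 𝓞 K) ∈ v.asIdeal) :
    v.valuation K (p : K) = exp (-((v.asIdeal.ramificationIdx ℤ : ℕ) : ℤ)) := by
  have hp0 : (p : 𝓞 K) ≠ 0 := by exact_mod_cast hp.ne_zero
  have hmap : (Ideal.span {(p : ℤ)}).map (algebraMap ℤ (𝓞 K)) = Ideal.span {(p : 𝓞 K)} := by
    rw [Ideal.map_span]; simp
  have hover : v.asIdeal.LiesOver (Ideal.span {(p : ℤ)}) := by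
    constructor
    have hmax : (Ideal.span {(p : ℤ)}).IsMaximal :=
      PrincipalIdealRing.isMaximal_of_irreducible (Nat.prime_iff_prime_int.mp hp).irreducible
    refine hmax.eq_of_le (Ideal.IsPrime.under ℤ v.asIdeal).ne_top ?_
    rw [Ideal.span_singleton_le_iff_mem, Ideal.mem_comap]
    simpa using hv
  have hne : (Ideal.span {(p : ℤ)}).map (algebraMap ℤ (𝓞 K)) ≠ ⊥ := by
    rw [hmap]; simpa using hp0
  rw [Ideal.IsDedekindDomain.ramificationIdx_eq_multiplicity (Ideal.span {(p : ℤ)}) _ hne, hmap,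
    ← v.intValuation_eq_exp_neg_multiplicity hp0, ← v.valuation_of_algebraMap (K := K)]
  simp

theorem primeOrd_eq_coe_iff {x : K} {w : ℤ} :
    primeOrd v x = w ↔ v.valuation K x = exp (-w) := by
  unfold primeOrd
  split_ifs with h
  · simp [h, exp_ne_zero.symm]
  · have h0 : v.valuation K x ≠ 0 := (Valuation.ne_zero_iff _).mpr h
    rw [WithTop.coe_inj, ← exp_log h0, exp_inj, log_exp]
    omega

theorem primeOrd_eq_top_iff {x : K} : primeOrd v x = ⊤ ↔ x = 0 := by
  unfold primeOrd
  split_ifs with h <;> simp [h]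

theorem irreducible_cyclotomic_adicCompletion {p : ℕ} (hp : p.Prime)
    (hv : (p : 𝓞 K) ∈ v.asIdeal)
    (hcyc : (algebraMap (v.adicCompletion K)
          (AlgebraicClosure (v.adicCompletion K))).fieldRange ⊓ padicCyclotomicSubfield p v
        = padicSubfieldInClosure v) (i : ℕ) :
    Irreducible (cyclotomic (p ^ i) (v.adicCompletion K)) := by
  have : CharZero (v.adicCompletion K) :=
    charZero_of_injective_algebraMap (algebraMap K (v.adicCompletion K)).injective
  have hp1 : Valued.v (p : v.adicCompletion K) < (1 : ℤᵐ⁰) := by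
    rw [← map_natCast (algebraMap K (v.adicCompletion K)), valued_algebraMap_adicCompletion]
    simpa using (v.valuation_lt_one_iff_mem (K := K) (p : 𝓞 K)).mpr hv
  refine irreducible_cyclotomic_of_inf_eq hp (padicSubfield v) hcyc ?_
  refine irreducible_cyclotomic_of_uniformizer
    ((Valued.v : Valuation (v.adicCompletion K) ℤᵐ⁰).comap (padicSubfield v).subtype) hp
    (by simpa using hp1) (fun x hx ↦ ?_) i
  simpa using Valued.map_le_of_mem_closure_bot hp hp1 x.2 hx

end AdicCompletion

/-- This is the meaning of the ceiling: after `j` extractions of a `p`-th root, each costing `e`,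
the distance `w - e * j` still exceeds `e / (p - 1)`. -/
theorem le_wieferichLevel_iff {p e : ℕ} (hp : 2 ≤ p) (he : 1 ≤ e) {w j : ℤ} :
    j ≤ wieferichLevel p e w ↔ (e : ℤ) < ((p : ℤ) - 1) * (w - e * j) := by
  have hp' : (0 : ℚ) < (p : ℚ) - 1 := by
    have : (2 : ℚ) ≤ p := by exact_mod_cast hp
    linarith
  have he' : (0 : ℚ) < e := by exact_mod_cast he
  rw [wieferichLevel, ← Int.sub_one_lt_iff, Int.lt_ceil, div_sub_div _ _ he'.ne' hp'.ne',
    lt_div_iff₀ (mul_pos he' hp')]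
  rw [← Int.cast_lt (R := ℚ)]
  push_cast
  constructor <;> intro h <;> linarith

/-! ### Existence and non-existence of `p`-power roots of units. -/

section Local

open WithZero

variable {L : Type*} [Field L] {p e s c N : ℕ} {a : L}

/-- The order of a `p ^ (k + 1)`-th power is divisible by `p ^ (k + 1)`. -/
theorem Valuation.pow_ne_of_map_eq_exp_neg (V : Valuation L ℤᵐ⁰) (hp : p.Prime) {h k : ℕ}
    (hh : ¬ p ∣ h) (ha : V a = exp (-((h * p ^ k : ℕ) : ℤ))) (d : L) : d ^ p ^ (k + 1) ≠ a := by
  rintro rfl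
  have h0 : V d ≠ 0 := by
    intro h0
    rw [map_pow, h0, zero_pow (pow_pos hp.pos _).ne'] at ha
    exact exp_ne_zero ha.symm
  rw [map_pow, ← exp_log h0, ← exp_nsmul, exp_inj, nsmul_eq_mul] at ha
  push_cast at ha
  have hpk : (p : ℤ) ^ k ≠ 0 := pow_ne_zero _ (by exact_mod_cast hp.ne_zero)
  have : (h : ℤ) = p * (-log (V d)) := mul_right_cancel₀ hpk (by linear_combination ha)
  exact hh (Int.natCast_dvd_natCast.mp ⟨_, this⟩)

variable [Valued L ℤᵐ⁰]

theorem Valued.map_pow_div_self_sub_one (ha : Valued.v a = (1 : ℤᵐ⁰)) (n : ℕ) :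
    (Valued.v (a ^ n / a - 1) : ℤᵐ⁰) = Valued.v (a ^ n - a) := by
  have ha0 : a ≠ 0 := by rintro rfl; simp at ha
  rw [show a ^ n / a - 1 = (a ^ n - a) / a by field_simp, map_div₀, ha, div_one]

variable [CompleteSpace L]

/-- Both `a ^ p ^ N` and the 1-unit `a ^ p ^ N / a` are `p ^ c`-th powers, hence so is their
quotient `a`. -/
theorem Valued.exists_pow_eq_unit (hp : p.Prime) (hp2 : p ≠ 2)
    (he : (Valued.v (p : L) : ℤᵐ⁰) = exp (-(e : ℤ))) (ha : Valued.v a = (1 : ℤᵐ⁰)) (hcN : c ≤ N)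
    (haN : a ^ p ^ N = a ∨ ∃ s : ℕ, Valued.v (a ^ p ^ N - a) = exp (-((c * e + s : ℕ) : ℤ)) ∧
      1 ≤ s ∧ e < (p - 1) * s) : ∃ x : L, x ^ p ^ c = a := by
  have ha0 : a ≠ 0 := by rintro rfl; simp at ha
  have hN : a ^ p ^ N = (a ^ p ^ (N - c)) ^ p ^ c := by
    rw [← pow_mul, ← pow_add, Nat.sub_add_cancel hcN]
  rcases haN with h | ⟨s, hs, hs1, hes⟩
  · exact ⟨a ^ p ^ (N - c), by rw [← hN, h]⟩
  · rw [← Valued.map_pow_div_self_sub_one ha] at hs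
    obtain ⟨x, hx, -⟩ := Valued.exists_pow_prime_pow_eq hp hp2 he c hs hs1 hes
    refine ⟨a ^ p ^ (N - c) / x, ?_⟩
    rw [div_pow, ← hN, hx]
    field_simp

/-- A `p ^ (c + 1)`-th root of `a` gives one of `a ^ p ^ N / a`. Uniqueness of `p ^ c`-th roots then
makes the `p ^ c`-th root `x`, at distance `s` from `1`, a `p`-th power, which its distance forbids.
-/
theorem Valued.pow_ne_unit [CharZero L] (hp : p.Prime) (hp2 : p ≠ 2)
    (he : (Valued.v (p : L) : ℤᵐ⁰) = exp (-(e : ℤ))) (he1 : 1 ≤ e)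
    (hcyc : Irreducible (cyclotomic p L)) (ha : Valued.v a = (1 : ℤᵐ⁰)) (hcN : c + 1 ≤ N)
    (haN : Valued.v (a ^ p ^ N - a) = exp (-((c * e + s : ℕ) : ℤ)))
    (hs : 1 ≤ s) (hps : ¬ p ∣ s) (hle : (p - 1) * s ≤ p * e) (hes : c = 0 ∨ e < (p - 1) * s)
    (d : L) : d ^ p ^ (c + 1) ≠ a := by
  intro hd
  have ha0 : a ≠ 0 := by rintro rfl; simp at ha
  rw [← Valued.map_pow_div_self_sub_one ha] at haN
  obtain ⟨x, hx, hxs⟩ : ∃ x : L, x ^ p ^ c = a ^ p ^ N / a ∧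
      Valued.v (x - 1) = exp (-(s : ℤ)) := by
    rcases hes with rfl | hes
    · exact ⟨a ^ p ^ N / a, by simp, by simpa using haN⟩
    · exact Valued.exists_pow_prime_pow_eq hp hp2 he c haN hs hes
  refine Valued.v.pow_prime_ne_of_not_dvd hp hp2 he he1 hxs hs hps hle
    (a ^ p ^ (N - (c + 1)) / d) (eq_of_pow_prime_pow_eq hp hp2 hcyc c ?_)
  rw [hx, ← pow_mul, ← pow_succ', div_pow, hd, ← pow_mul, ← pow_add, Nat.sub_add_cancel hcN]

end Local

/-! ### The main theorem. -/

open WithZero in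
theorem proposition8p1 {K : Type*} [Field K] [NumberField K]
    (p : ℕ) (hp : p.Prime) (hp_odd : p ≠ 2)
    (v : HeightOneSpectrum (𝓞 K)) (hv : (p : 𝓞 K) ∈ v.asIdeal)
    (e f : ℕ) (he : e = v.asIdeal.ramificationIdx ℤ) (hf : f = v.asIdeal.inertiaDeg ℤ)
    (hep : ¬ p ∣ e)
    (hcyc : (algebraMap (v.adicCompletion K)
          (AlgebraicClosure (v.adicCompletion K))).fieldRange ⊓ padicCyclotomicSubfield p v
        = padicSubfieldInClosure v)
    (m : ℕ) (a : 𝓞 K) (hirr : Irreducible (X ^ p ^ m - C a : (𝓞 K)[X]))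
    (π : 𝓞 K) (hπ : primeOrd v (π : K) = 1)
    (a₀ : K) (ha₀ : primeOrd v a₀ = 0)
    (h k : ℕ) (hh : ¬ p ∣ h) (ha : (a : K) = a₀ * (π : K) ^ (h * p ^ k))
    (μ : ℕ) (hμ_pos : 1 ≤ μ) (hμ_le : μ ≤ f) (hμ : μ ≡ m [MOD f])
    (w₀ : WithTop ℤ) (hw₀ : w₀ = primeOrd v (a₀ ^ p ^ (f - μ + m) - a₀))
    (hw_nonpos : ∀ w : ℤ, w₀ = w → wieferichLevel p e w ≤ 0 → ¬ (p : ℤ) ∣ w)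
    (hw_lt : ∀ w : ℤ, w₀ = w → wieferichLevel p e w < m →
      ¬ (p : ℤ) ∣ (e : ℤ) * wieferichLevel p e w - w)
    (c : ℕ)
    (hc : (c : WithTop ℤ) =
      max 0 (min (m : WithTop ℤ) (min (wieferichLevelTop p e w₀) (k : WithTop ℤ)))) :
    (∃ α : v.adicCompletion K, α ^ p ^ c = algebraMap K (v.adicCompletion K) a) ∧
    ∀ α : v.adicCompletion K, α ^ p ^ c = algebraMap K (v.adicCompletion K) a →
      ∃ Φ : ℕ → (v.adicCompletion K)[X],
        (∀ i ∈ Finset.Icc 1 c, ∀ ζ : AlgebraicClosure (v.adicCompletion K),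
          IsPrimitiveRoot ζ (p ^ i) →
          (Φ i).map (algebraMap (v.adicCompletion K) (AlgebraicClosure (v.adicCompletion K))) =
            twistedCyclotomic p i ζ
              (algebraMap (v.adicCompletion K) (AlgebraicClosure (v.adicCompletion K)) α)) ∧
        (X ^ p ^ m - C (algebraMap K (v.adicCompletion K) a) : (v.adicCompletion K)[X]) =
          (X ^ p ^ (m - c) - C α) *
            ∏ i ∈ Finset.Icc 1 c, (Φ i).comp (X ^ p ^ (m - c)) ∧
        Irreducible (X ^ p ^ (m - c) - C α : (v.adicCompletion K)[X]) ∧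
        ∀ i ∈ Finset.Icc 1 c, Irreducible ((Φ i).comp (X ^ p ^ (m - c))) := by
  have : CharZero (v.adicCompletion K) :=
    charZero_of_injective_algebraMap (algebraMap K (v.adicCompletion K)).injective
  have hp2 := hp.two_le
  have hcycirr := irreducible_cyclotomic_adicCompletion v hp hv hcyc
  have hVp : Valued.v (p : v.adicCompletion K) = exp (-(e : ℤ)) := by
    rw [← map_natCast (algebraMap K (v.adicCompletion K)), valued_algebraMap_adicCompletion,
      valuation_natCast_eq_exp_neg_ramificationIdx v hp hv, he]
  have he1 : 1 ≤ e := Nat.one_le_iff_ne_zero.mpr (by rintro rfl; exact hep (dvd_zero p))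
  set A := algebraMap K (v.adicCompletion K) with hA
  have hVa₀ : Valued.v (A a₀) = (1 : ℤᵐ⁰) := by
    rw [hA, valued_algebraMap_adicCompletion, (primeOrd_eq_coe_iff v (w := 0)).mp ha₀]; simp
  have hVπ : Valued.v (A π) = exp (-1 : ℤ) := by
    rw [hA, valued_algebraMap_adicCompletion, (primeOrd_eq_coe_iff v (w := 1)).mp hπ]
  have hAa : A a = A a₀ * A π ^ (h * p ^ k) := by rw [ha, map_mul, map_pow]
  have hVa : Valued.v (A a) = exp (-((h * p ^ k : ℕ) : ℤ)) := by
    rw [hAa, map_mul, hVa₀, one_mul, map_pow, hVπ]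
    exact (exp_neg_natCast_pow 1 _).trans (by rw [mul_one])
  have hAπ0 : A π ≠ 0 := by
    intro h0; rw [h0, map_zero] at hVπ; exact exp_ne_zero hVπ.symm
  have hAa0 : A a ≠ 0 := by
    intro h0; rw [h0, map_zero] at hVa; exact exp_ne_zero hVa.symm
  set N := f - μ + m with hN
  have hcm : c ≤ m ∧ c ≤ k := by
    have h1 : (c : WithTop ℤ) ≤ max 0 (min (m : WithTop ℤ) k) := by
      rw [hc]
      exact max_le_max le_rfl (min_le_min le_rfl (min_le_right _ _))
    rw [max_eq_right (le_min (by positivity) (by positivity))] at h1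
    exact ⟨by exact_mod_cast h1.trans (min_le_left _ _),
      by exact_mod_cast h1.trans (min_le_right _ _)⟩
  have hVsub : Valued.v (A a₀ ^ p ^ N - A a₀) = v.valuation K (a₀ ^ p ^ N - a₀) := by
    rw [← map_pow, ← map_sub, hA, valued_algebraMap_adicCompletion]
  have hw₀cases : (A a₀ ^ p ^ N = A a₀ ∧ c = min m k) ∨
      ∃ w : ℕ, 1 ≤ w ∧ w₀ = ((w : ℤ) : WithTop ℤ) ∧
      Valued.v (A a₀ ^ p ^ N - A a₀) = exp (-(w : ℤ)) ∧
      (c : ℤ) = max 0 (min (m : ℤ) (min (wieferichLevel p e w) k)) := by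
    induction w₀ using WithTop.recTopCoe with
    | top =>
      refine .inl ⟨?_, ?_⟩
      · rw [← map_pow]
        exact congrArg A (sub_eq_zero.mp ((primeOrd_eq_top_iff v).mp hw₀.symm))
      · rw [wieferichLevelTop, WithTop.map_top, min_eq_right le_top,
          max_eq_right (le_min (by positivity) (by positivity))] at hc
        rw [show min (m : WithTop ℤ) k = ((min m k : ℕ) : WithTop ℤ) from
          (Nat.mono_cast.map_min).symm] at hc
        exact_mod_cast hc
    | coe w =>
      have hVw := (primeOrd_eq_coe_iff v).mp hw₀.symm
      rw [← hVsub] at hVw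
      have hw0 : 0 ≤ w := by
        have : Valued.v (A a₀ ^ p ^ N - A a₀) ≤ (1 : ℤᵐ⁰) :=
          Valuation.map_sub_le _ (by rw [map_pow, hVa₀, one_pow]) hVa₀.le
        rw [hVw, ← exp_zero, exp_le_exp] at this
        omega
      -- For `w = 0` the level is at most `0`, and the condition `¬ p ∣ w` fails; so `a₀ ^ p ^ N /
      -- a₀` is a 1-unit.
      have hw1 : w ≠ 0 := by
        rintro rfl
        refine hw_nonpos 0 rfl (not_lt.mp fun hlt ↦ ?_) (dvd_zero _)
        have := (le_wieferichLevel_iff (j := 1) hp2 he1).mp hlt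
        have h1 : (0 : ℤ) ≤ ((p : ℤ) - 1) * e := mul_nonneg (by omega) (by omega)
        nlinarith
      lift w to ℕ using hw0
      refine .inr ⟨w, by omega, rfl, hVw, ?_⟩
      rw [wieferichLevelTop, WithTop.map_coe] at hc
      exact_mod_cast hc
  have hpcast : ((p - 1 : ℕ) : ℤ) = (p : ℤ) - 1 := by push_cast [show 1 ≤ p by omega]; ring
  -- the order of `a₀ ^ p ^ N - a₀` exceeds `c * e` by `s`
  have hbound : ∀ w s : ℕ, w = c * e + s → ((c : ℤ) ≤ wieferichLevel p e w ↔ e < (p - 1) * s) := by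
    rintro w s rfl
    rw [le_wieferichLevel_iff hp2 he1, ← Int.ofNat_lt]
    push_cast [hpcast]
    ring_nf
  refine ⟨?_, fun α hα ↦ ⟨fun i ↦ (cyclotomic (p ^ i) _).scaleRoots α, ?_, ?_, ?_, ?_⟩⟩
  · rcases Nat.eq_zero_or_pos c with rfl | hcpos
    · exact ⟨A a, by simp⟩
    obtain ⟨x, hx⟩ : ∃ x, x ^ p ^ c = A a₀ := by
      refine Valued.exists_pow_eq_unit hp hp_odd hVp hVa₀ (N := N) (by omega) ?_
      rcases hw₀cases with ⟨h1, -⟩ | ⟨w, hw1, -, hVw, hcw⟩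
      · exact .inl h1
      · have hcl : (c : ℤ) ≤ wieferichLevel p e w := by omega
        have hlt := (le_wieferichLevel_iff hp2 he1).mp hcl
        have hpos : (0 : ℤ) < w - e * c := by
          by_contra hneg
          have : (0 : ℤ) ≤ (p : ℤ) - 1 := by omega
          nlinarith
        obtain ⟨s, rfl⟩ : ∃ s, w = c * e + s :=
          Nat.exists_eq_add_of_le (by rw [← Int.ofNat_le]; push_cast; linarith)
        refine .inr ⟨s, hVw, ?_, (hbound _ s rfl).mp hcl⟩
        push_cast at hpos
        have : (0 : ℤ) < s := by linarith
        omega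
    refine ⟨x * A π ^ (h * p ^ (k - c)), ?_⟩
    rw [mul_pow, hx, ← pow_mul, mul_assoc, ← pow_add, Nat.sub_add_cancel hcm.2, hAa]
  · intro i hi ζ hζ
    rw [twistedCyclotomic_eq_scaleRoots hp (Finset.mem_Icc.mp hi).1 hζ, map_scaleRoots,
      map_cyclotomic]
    rw [(cyclotomic.monic _ _).leadingCoeff, map_one]
    exact one_ne_zero
  · rw [← hα]
    exact X_pow_prime_pow_sub_C_eq_prod hp hcm.1 α
  · rcases hcm.1.eq_or_lt with rfl | hclt
    · simpa using irreducible_X_sub_C α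
    refine X_pow_sub_C_irreducible_of_prime_pow hp hp_odd _ ?_
    -- If `α = δ ^ p`, then `δ` is a `p ^ (c + 1)`-th root of `a`. For `c = k` the order of `a`
    -- excludes this; for `c < k`, dividing by a power of `π` gives such a root of `a₀`.
    rintro δ rfl
    rw [← pow_mul, ← pow_succ'] at hα
    rcases hcm.2.eq_or_lt with rfl | hck
    · exact Valued.v.pow_ne_of_map_eq_exp_neg hp hh hVa δ hα
    rcases hw₀cases with ⟨-, h2⟩ | ⟨w, hw1, hww, hVw, hcw⟩
    · omega
    have hd : (δ / A π ^ (h * p ^ (k - (c + 1)))) ^ p ^ (c + 1) = A a₀ := by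
      rw [div_pow, hα, ← pow_mul, mul_assoc, ← pow_add, Nat.sub_add_cancel hck, hAa]
      field_simp
    have hlc : ¬ ((c + 1 : ℕ) : ℤ) ≤ wieferichLevel p e w := by push_cast; omega
    rw [le_wieferichLevel_iff hp2 he1] at hlc
    -- Since `c < m` and `c < k`, only the level or the truncation at `0` can have determined `c`;
    -- the two cases match the two non-divisibility hypotheses.
    have hcase : c = 0 ∨ (c : ℤ) = wieferichLevel p e w := by omega
    obtain ⟨s, hws, hs1⟩ : ∃ s, w = c * e + s ∧ 1 ≤ s := by
      rcases hcase with rfl | hcl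
      · exact ⟨w, by simp, hw1⟩
      · have hlt := (le_wieferichLevel_iff hp2 he1).mp hcl.le
        have hpos : (0 : ℤ) < w - e * c := by
          by_contra hneg
          have : (0 : ℤ) ≤ (p : ℤ) - 1 := by omega
          nlinarith
        obtain ⟨s, rfl⟩ : ∃ s, w = c * e + s :=
          Nat.exists_eq_add_of_le (by rw [← Int.ofNat_le]; push_cast; linarith)
        push_cast at hpos
        have : (0 : ℤ) < s := by linarith
        exact ⟨s, rfl, by omega⟩
    refine Valued.pow_ne_unit (N := N) (s := s) (c := c) hp hp_odd hVp he1
      (by simpa using hcycirr 1) hVa₀ (by omega) (by rw [hVw, hws]) hs1 ?_ ?_ ?_ _ hd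
    · intro hps
      have hps' : (p : ℤ) ∣ s := Int.natCast_dvd_natCast.mpr hps
      by_cases hl : wieferichLevel p e w ≤ 0
      · obtain rfl : c = 0 := by omega
        refine hw_nonpos w hww hl ?_
        rw [hws]; simpa using hps'
      · have hcl : (c : ℤ) = wieferichLevel p e w := by omega
        refine hw_lt w hww (by omega) ?_
        rw [← hcl, hws]
        push_cast
        rw [show (e : ℤ) * c - (c * e + s) = -s by ring]
        exact (dvd_neg).mpr hps'
    · rw [← Int.ofNat_le]
      rw [hws] at hlc
      push_cast [hpcast] at hlc ⊢
      linarith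
    · exact hcase.imp_right fun hcl ↦ (hbound w s hws).mp hcl.le
  · intro i hi
    refine irreducible_scaleRoots_cyclotomic_comp hp hp_odd hcycirr (Finset.mem_Icc.mp hi).1 ?_ _
    rintro rfl
    rw [zero_pow (pow_pos hp.pos _).ne'] at hα
    exact hAa0 hα.symm
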